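/- Let $\Omega\subset\mathbb R^d$, $d\in\{2,3\}$, be a bounded polyhedral domain with Lipschitz boundary, let $\nu,\sigma,T>0$, let $N\ge 1$ be an integer, $\Delta t=T/N$, $t_n=n\Delta t$, and let $f$ be a force with values $f^n=f(t_n)\in \mathbf H^{-1}$, the dual of $\mathbf X=[H_0^1(\Omega)]^d$, where $\mathbf X$ is normed by $\|\nabla v\|_{L^2}$. Write $(\cdot,\cdot)$ for the $L^2(\Omega)$ inner products and $$b(u,v,w)=\tfrac12\big[((u\cdot\nabla)v,w)-((u\cdot\nabla)w,v)\big].$$ Let $\mathcal T_h$ be a conforming affine-equivalent triangulation of $\overline\Omega$ by triangles or tetrahedra (local spaces $\mathbb P^m$) or by quadrilaterals or hexahedra (local spaces $\mathbb Q^m$), let $Y_h^m$ be the space of continuous functions on $\overline\Omega$ that belong to the local space of order $m$ on every cell, let $l\ge 2$, $\mathbf X_h=[Y_h^l]^d\cap\mathbf X$ and $Q_h=Y_h^l$. Let $\Pi_h$ be a linear projection or interpolation operator from $[L^2(\Omega)]^d$ to $[Y_h^{l-1}]^d$, $\Pi_h^*=\mathrm{Id}-\Pi_h$, and, with $\tau_K>0$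 for each cell $K$, let $(v,w)_\tau=\sum_{K}\tau_K(v,w)_{L^2(K)}$ and $\|v\|_\tau=(v,v)_\tau^{1/2}$. For subspaces $X\subset\mathbf X_h$, $Q\subset Q_h$ and an initial velocity $u^0\in X$, the fully implicit backward Euler LPS scheme on $(X,Q)$ reads: for $n=0,\dots,N-1$, given $u^n\in X$, find $(u^{n+1},p^{n+1})\in X\times Q$ such that, for all $(\varphi,\psi)\in X\times Q$, $$\Big(\tfrac{u^{n+1}-u^n}{\Delta t},\varphi\Big)+b(u^{n+1},u^{n+1},\varphi)+\nu(\nabla u^{n+1},\nabla\varphi)-(p^{n+1},\nabla\cdot\varphi)=\langle f^{n+1},\varphi\rangle,$$ $$(\nabla\cdot u^{n+1},\psi)+(\Pi_h^*\nabla p^{n+1},\Pi_h^*\nabla\psi)_\tau+\sigma(p^{n+1},\psi)=0.$$ Let $(u_h^n,p_h^n)$ be a solution of this scheme on $(\mathbf X_h,Q_h)$ with initial velocity $u_{0h}\in\mathbf X_h$. Let $\varphi_1,\dots,\varphi_r$ and $\psi_1,\dots,\psi_r$ be the $L^2$-POD bases of the snapshots $u_h^1,\dots,u_h^N$ and $p_h^1,\dots,p_h^N$,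 given by the formula $\varphi_i=\lambda_i^{-1/2}\Delta t^{1/2}\sum_{n=1}^N(a_i)_n u_h^n$, where $a_1,\dots,a_r$ are orthonormal eigenvectors of the matrix $\big(\Delta t\,(u_h^n,u_h^m)\big)_{m,n=1}^N$ for its $r$ largest eigenvalues $\lambda_1\ge\dots\ge\lambda_r>0$, and similarly for $\psi_i$ (the $r$ largest eigenvalues are assumed to be positive in both cases). Let $\mathbf X_r=\mathrm{span}\{\varphi_i\}$, $Q_r=\mathrm{span}\{\psi_i\}$. Then the LPS-ROM, i.e. the scheme on $(\mathbf X_r,Q_r)$ with $u_r^0=\sum_{i=1}^r(u_{0h},\varphi_i)\varphi_i$, has a solution; more precisely, each of its time steps has a solution $(u_r^{n+1},p_r^{n+1})\in\mathbf X_r\times Q_r$ for every given $u_r^n\in\mathbf X_r$. Every solution satisfies, for $k=0,\dots,N$, $$\|u_r^k\|_{L^2}^2+\sum_{n=0}^{k-1}\|u_r^{n+1}-u_r^n\|_{L^2}^2+\Delta t\sum_{n=0}^{k-1}\Big(\nu\|\nabla u_r^{n+1}\|_{L^2}^2+\|\Pi_h^*(\nabla p_r^{n+1})\|_\tau^2+\sigma\|p_r^{n+1}\|_{L^2}^2\Big)\le\|u_r^0\|_{L^2}^2+\frac{4\Delta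 t}{\nu}\sum_{n=0}^{k-1}\|f^{n+1}\|_{\mathbf H^{-1}}^2 .$$ -/

import Mathlib

open MeasureTheory Set
open scoped ContDiff

noncomputable section

namespace LPSROM

/-! ### Lebesgue and Sobolev spaces -/

/-- The space `ℝ^d` with its Euclidean structure. -/
abbrev Pt (d : ℕ) := EuclideanSpace ℝ (Fin d)

/-- Real `d × d` tensors with the Frobenius inner product. -/
abbrev Tens (d : ℕ) := EuclideanSpace ℝ (Fin d × Fin d)

/-- `L²(Ω; F)` with respect to Lebesgue measure. -/
abbrev L2 {d : ℕ} (Ω : Set (Pt d)) (F : Type) [NormedAddCommGroup F] :=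
  Lp F 2 (volume.restrict Ω)

/-- The `j`-th classical partial derivative of a scalar function. -/
def partialDeriv {d : ℕ} (j : Fin d) (φ : Pt d → ℝ) (x : Pt d) : ℝ :=
  fderiv ℝ φ x (EuclideanSpace.single j 1)

/-- The classical gradient of a vector field, `(∇φ)_{ij} = ∂_j φ_i`. -/
def gradClassical {d : ℕ} (φ : Pt d → Pt d) (x : Pt d) : Tens d :=
  WithLp.toLp 2 fun ij => partialDeriv ij.2 (fun y => φ y ij.1) x

/-- `φ ∈ C_c^∞(Ω; F)`. -/
structure IsTest {d : ℕ} (Ω : Set (Pt d)) {F : Type} [NormedAddCommGroup F] [NormedSpace ℝ F]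
    (φ : Pt d → F) : Prop where
  smooth : ContDiff ℝ ∞ φ
  compact : HasCompactSupport φ
  support : tsupport φ ⊆ Ω

theorem IsTest.comp {d : ℕ} {Ω : Set (Pt d)} {φ : Pt d → Pt d} (h : IsTest Ω φ) (i : Fin d) :
    ContDiff ℝ ∞ fun y => φ y i := by
  have := h.smooth
  fun_prop

theorem IsTest.comp_differentiable {d : ℕ} {Ω : Set (Pt d)} {φ : Pt d → Pt d} (h : IsTest Ω φ)
    (i : Fin d) : Differentiable ℝ fun y => φ y i :=
  (h.comp i).differentiable (by simp)

theorem isTest_zero {d : ℕ} (Ω : Set (Pt d)) : IsTest Ω (0 : Pt d → Pt d) :=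
  ⟨contDiff_const, HasCompactSupport.zero, by simp [tsupport]⟩

theorem IsTest.add {d : ℕ} {Ω : Set (Pt d)} {φ ψ : Pt d → Pt d} (h : IsTest Ω φ)
    (k : IsTest Ω ψ) : IsTest Ω (φ + ψ) :=
  ⟨h.smooth.add k.smooth, h.compact.add k.compact,
    (tsupport_add φ ψ).trans (union_subset h.support k.support)⟩

theorem IsTest.smul {d : ℕ} {Ω : Set (Pt d)} {φ : Pt d → Pt d} (c : ℝ) (h : IsTest Ω φ) :
    IsTest Ω (c • φ) :=
  ⟨h.smooth.const_smul c, h.compact.mono (Function.support_const_smul_subset c φ),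
    (closure_mono (Function.support_const_smul_subset c φ)).trans h.support⟩

theorem gradClassical_zero {d : ℕ} : gradClassical (0 : Pt d → Pt d) = 0 := by
  funext x
  ext ij
  simp [gradClassical, partialDeriv]

theorem gradClassical_add {d : ℕ} {Ω : Set (Pt d)} {φ ψ : Pt d → Pt d} (h : IsTest Ω φ)
    (k : IsTest Ω ψ) : gradClassical (φ + ψ) = gradClassical φ + gradClassical ψ := by
  funext x
  ext ij
  have := fderiv_fun_add (h.comp_differentiable ij.1 x) (k.comp_differentiable ij.1 x)
  simp [gradClassical, partialDeriv, this]

theorem gradClassical_smul {d : ℕ} {Ω : Set (Pt d)} {φ : Pt d → Pt d} (c : ℝ)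
    (h : IsTest Ω φ) : gradClassical (c • φ) = c • gradClassical φ := by
  funext x
  ext ij
  have := fderiv_fun_const_smul (h.comp_differentiable ij.1 x) c
  simp only [smul_eq_mul] at this
  simp [gradClassical, partialDeriv, this]

/-- The graph `{(φ, ∇φ) : φ ∈ C_c^∞(Ω; ℝ^d)}` inside `L²(Ω; ℝ^d) × L²(Ω; ℝ^{d × d})`. -/
def testGraph {d : ℕ} (Ω : Set (Pt d)) : Submodule ℝ (L2 Ω (Pt d) × L2 Ω (Tens d)) where
  carrier := {z | ∃ φ : Pt d → Pt d, IsTest Ω φ ∧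
    z.1 =ᵐ[volume.restrict Ω] φ ∧ z.2 =ᵐ[volume.restrict Ω] gradClassical φ}
  zero_mem' := ⟨0, isTest_zero Ω, Lp.coeFn_zero _ _ _, by
    rw [gradClassical_zero]; exact Lp.coeFn_zero _ _ _⟩
  add_mem' := by
    rintro y z ⟨φ, hφ, h1, h2⟩ ⟨ψ, hψ, k1, k2⟩
    refine ⟨φ + ψ, hφ.add hψ, (Lp.coeFn_add _ _).trans (h1.add k1), ?_⟩
    rw [gradClassical_add hφ hψ]
    exact (Lp.coeFn_add _ _).trans (h2.add k2)
  smul_mem' := by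
    rintro c z ⟨φ, hφ, h1, h2⟩
    refine ⟨c • φ, hφ.smul c, (Lp.coeFn_smul _ _).trans (h1.const_smul c), ?_⟩
    rw [gradClassical_smul c hφ]
    exact (Lp.coeFn_smul _ _).trans (h2.const_smul c)

/-- The velocity space `[H_0^1(Ω)]^d`, the closure of `C_c^∞(Ω; ℝ^d)` in `[H^1(Ω)]^d`. An element
is represented by the pair `(v, ∇v)` of the function and its weak gradient. -/
def H10 {d : ℕ} (Ω : Set (Pt d)) : Type := ↥(testGraph Ω).topologicalClosure

namespace H10

variable {d : ℕ} {Ω : Set (Pt d)}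

instance : AddCommGroup (H10 Ω) := inferInstanceAs (AddCommGroup ↥(testGraph Ω).topologicalClosure)

instance : Module ℝ (H10 Ω) := inferInstanceAs (Module ℝ ↥(testGraph Ω).topologicalClosure)

/-- The embedding of `[H_0^1(Ω)]^d` into `L²`. -/
def toL2 : H10 Ω →ₗ[ℝ] L2 Ω (Pt d) :=
  LinearMap.fst ℝ _ _ ∘ₗ (testGraph Ω).topologicalClosure.subtype

/-- The weak gradient, `(∇v)_{ij} = ∂_j v_i`. -/
def grad : H10 Ω →ₗ[ℝ] L2 Ω (Tens d) :=
  LinearMap.snd ℝ _ _ ∘ₗ (testGraph Ω).topologicalClosure.subtype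

/-- The weak divergence, i.e. the trace of the weak gradient. -/
def div : H10 Ω →ₗ[ℝ] L2 Ω ℝ :=
  ((∑ i : Fin d, EuclideanSpace.proj (i, i) : Tens d →L[ℝ] ℝ).compLpL 2
    (volume.restrict Ω)).toLinearMap ∘ₗ grad

/-- `[H_0^1(Ω)]^d` carries the norm `‖v‖ = ‖∇v‖_{L²}`. (On a bounded `Ω` it is equivalent to the
`H^1`-norm, by the Poincaré inequality; its definiteness is not needed for the definitions.) -/
instance : SeminormedAddCommGroup (H10 Ω) :=
  SeminormedAddCommGroup.induced (H10 Ω) (L2 Ω (Tens d)) (grad : H10 Ω →ₗ[ℝ] L2 Ω (Tens d))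

instance : NormedSpace ℝ (H10 Ω) :=
  NormedSpace.induced ℝ (H10 Ω) (L2 Ω (Tens d)) (grad : H10 Ω →ₗ[ℝ] L2 Ω (Tens d))

theorem norm_eq (v : H10 Ω) : ‖v‖ = ‖grad v‖ := rfl

end H10

/-- The dual `H^{-1}` of the velocity space; its norm is the operator norm
`sup ⟨f, v⟩ / ‖∇v‖_{L²}`. -/
abbrev HMinusOne {d : ℕ} (Ω : Set (Pt d)) := H10 Ω →L[ℝ] ℝ

theorem integrable_mul_test {d : ℕ} {Ω : Set (Pt d)} {u : Pt d → ℝ}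
    (hu : MemLp u 2 (volume.restrict Ω)) {φ : Pt d → ℝ} (hφ : Continuous φ)
    (hc : HasCompactSupport φ) : Integrable (fun x => u x * φ x) (volume.restrict Ω) :=
  MemLp.integrable_mul (p := 2) (q := 2) hu (hφ.memLp_of_hasCompactSupport hc)

theorem IsTest.continuous_partialDeriv {d : ℕ} {Ω : Set (Pt d)} {φ : Pt d → ℝ} (h : IsTest Ω φ)
    (j : Fin d) : Continuous (partialDeriv j φ) :=
  (h.smooth.continuous_fderiv (by simp)).clm_apply continuous_const

theorem IsTest.hasCompactSupport_partialDeriv {d : ℕ} {Ω : Set (Pt d)} {φ : Pt d → ℝ}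
    (h : IsTest Ω φ) (j : Fin d) : HasCompactSupport (partialDeriv j φ) :=
  h.compact.fderiv_apply (𝕜 := ℝ) _

theorem memLp_coord {d : ℕ} {Ω : Set (Pt d)} (g : L2 Ω (Pt d)) (j : Fin d) :
    MemLp (fun x => g x j) 2 (volume.restrict Ω) :=
  (EuclideanSpace.proj j : Pt d →L[ℝ] ℝ).comp_memLp' (Lp.memLp g)

/-- The graph of the weak gradient: pairs `(q, g)` of a function `q ∈ L²(Ω)` and its weak
gradient `g ∈ L²(Ω; ℝ^d)`. -/
def weakGradGraph {d : ℕ} (Ω : Set (Pt d)) : Submodule ℝ (L2 Ω ℝ × L2 Ω (Pt d)) where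
  carrier := {z | ∀ φ : Pt d → ℝ, IsTest Ω φ → ∀ j : Fin d,
    ∫ x in Ω, z.1 x * partialDeriv j φ x = -∫ x in Ω, z.2 x j * φ x}
  zero_mem' := by
    intro φ hφ j
    have h1 : ∫ x in Ω, (0 : L2 Ω ℝ) x * partialDeriv j φ x = 0 := by
      refine integral_eq_zero_of_ae ?_
      filter_upwards [Lp.coeFn_zero ℝ 2 (volume.restrict Ω)] with x hx
      rw [hx, Pi.zero_apply, zero_mul]
    have h2 : ∫ x in Ω, (0 : L2 Ω (Pt d)) x j * φ x = 0 := by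
      refine integral_eq_zero_of_ae ?_
      filter_upwards [Lp.coeFn_zero (Pt d) 2 (volume.restrict Ω)] with x hx
      rw [hx, Pi.zero_apply, PiLp.zero_apply, zero_mul, Pi.zero_apply]
    change ∫ x in Ω, (0 : L2 Ω ℝ) x * partialDeriv j φ x = -∫ x in Ω, (0 : L2 Ω (Pt d)) x j * φ x
    rw [h1, h2, neg_zero]
  add_mem' := by
    intro y z hy hz φ hφ j
    have h1 : ∫ x in Ω, (y.1 + z.1) x * partialDeriv j φ x =
        ∫ x in Ω, (y.1 x * partialDeriv j φ x + z.1 x * partialDeriv j φ x) := by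
      refine integral_congr_ae ?_
      filter_upwards [Lp.coeFn_add y.1 z.1] with x hx
      rw [hx, Pi.add_apply, add_mul]
    have h2 : ∫ x in Ω, (y.2 + z.2) x j * φ x =
        ∫ x in Ω, (y.2 x j * φ x + z.2 x j * φ x) := by
      refine integral_congr_ae ?_
      filter_upwards [Lp.coeFn_add y.2 z.2] with x hx
      rw [hx, Pi.add_apply, PiLp.add_apply, add_mul]
    have c1 := hφ.continuous_partialDeriv j
    have c2 := hφ.hasCompactSupport_partialDeriv j
    have c3 := hφ.smooth.continuous
    change ∫ x in Ω, (y.1 + z.1) x * partialDeriv j φ x = -∫ x in Ω, (y.2 + z.2) x j * φ x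
    rw [h1, h2, integral_add (integrable_mul_test (Lp.memLp y.1) c1 c2)
        (integrable_mul_test (Lp.memLp z.1) c1 c2),
      integral_add (integrable_mul_test (memLp_coord y.2 j) c3 hφ.compact)
        (integrable_mul_test (memLp_coord z.2 j) c3 hφ.compact), hy φ hφ j, hz φ hφ j]
    ring
  smul_mem' := by
    intro c z hz φ hφ j
    have h1 : ∫ x in Ω, (c • z.1) x * partialDeriv j φ x =
        ∫ x in Ω, c * (z.1 x * partialDeriv j φ x) := by
      refine integral_congr_ae ?_
      filter_upwards [Lp.coeFn_smul c z.1] with x hx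
      rw [hx, Pi.smul_apply, smul_eq_mul, mul_assoc]
    have h2 : ∫ x in Ω, (c • z.2) x j * φ x = ∫ x in Ω, c * (z.2 x j * φ x) := by
      refine integral_congr_ae ?_
      filter_upwards [Lp.coeFn_smul c z.2] with x hx
      rw [hx, Pi.smul_apply, PiLp.smul_apply, smul_eq_mul, mul_assoc]
    change ∫ x in Ω, (c • z.1) x * partialDeriv j φ x = -∫ x in Ω, (c • z.2) x j * φ x
    rw [h1, h2, integral_const_mul, integral_const_mul, hz φ hφ j]
    ring

/-- The scalar Sobolev space `H^1(Ω)`; an element is represented by the pair `(q, ∇q)`. -/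
def H1 {d : ℕ} (Ω : Set (Pt d)) : Type := ↥(weakGradGraph Ω)

namespace H1

variable {d : ℕ} {Ω : Set (Pt d)}

instance : AddCommGroup (H1 Ω) := inferInstanceAs (AddCommGroup ↥(weakGradGraph Ω))

instance : Module ℝ (H1 Ω) := inferInstanceAs (Module ℝ ↥(weakGradGraph Ω))

/-- The embedding of `H^1(Ω)` into `L²(Ω)`. -/
def toL2 : H1 Ω →ₗ[ℝ] L2 Ω ℝ := LinearMap.fst ℝ _ _ ∘ₗ (weakGradGraph Ω).subtype

/-- The weak gradient of a scalar function. -/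
def grad : H1 Ω →ₗ[ℝ] L2 Ω (Pt d) := LinearMap.snd ℝ _ _ ∘ₗ (weakGradGraph Ω).subtype

end H1

/-- `b(u, v, w) = ½ [((u · ∇) v, w) - ((u · ∇) w, v)]`. -/
def convForm {d : ℕ} {Ω : Set (Pt d)} (u v w : H10 Ω) : ℝ :=
  (1 / 2) * ((∫ x in Ω, ∑ i, ∑ j, u.toL2 x j * v.grad x (i, j) * w.toL2 x i) -
    ∫ x in Ω, ∑ i, ∑ j, u.toL2 x j * w.grad x (i, j) * v.toL2 x i)

/-! ### Triangulations and finite element spaces -/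

/-- Simplicial cells (triangles, tetrahedra) or box-type cells (quadrilaterals, hexahedra). -/
inductive CellShape
  | simplex
  | box

/-- The reference cell. -/
def CellShape.ref (d : ℕ) : CellShape → Set (Pt d)
  | simplex => {x | (∀ i, 0 ≤ x i) ∧ ∑ i, x i ≤ 1}
  | box => {x | ∀ i, 0 ≤ x i ∧ x i ≤ 1}

/-- The polynomials on the reference cell: `ℙ^l` (total degree at most `l`) on the simplex, `ℚ^l`
(degree at most `l` in each variable) on the box. -/
def CellShape.poly (d l : ℕ) : CellShape → Submodule ℝ (MvPolynomial (Fin d) ℝ)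
  | simplex => MvPolynomial.restrictTotalDegree (Fin d) ℝ l
  | box => MvPolynomial.restrictDegree (Fin d) ℝ l

/-- An affine-equivalent conforming triangulation of the closure of `Ω`: every cell is the image of
one reference cell under an invertible affine map, the cells cover the closure of `Ω`, do not
overlap, and two different cells meet in a common face (which may be empty); the nonempty faces of
a polytope are its nonempty exposed subsets. -/
structure Mesh {d : ℕ} (Ω : Set (Pt d)) where
  shape : CellShape
  numCells : ℕ
  map : Fin numCells → (Pt d ≃ᵃ[ℝ] Pt d)
  cover : ⋃ K, map K '' shape.ref d = closure Ω
  nonoverlap : ∀ K L, K ≠ L →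
    Disjoint (interior (map K '' shape.ref d)) (interior (map L '' shape.ref d))
  conforming : ∀ K L, K ≠ L →
    IsExposed ℝ (map K '' shape.ref d) (map K '' shape.ref d ∩ map L '' shape.ref d)

namespace Mesh

variable {d : ℕ} {Ω : Set (Pt d)} (M : Mesh Ω)

/-- The mesh cell with index `K`. -/
def cell (K : Fin M.numCells) : Set (Pt d) := M.map K '' M.shape.ref d

/-- `Y_h^l`: functions that are continuous on the closure of `Ω` and, on every cell `K`, a
polynomial of the local space of order `l` in the coordinates of the reference cell. (Values outside
the closure of `Ω` play no role.) -/
def Yh (l : ℕ) : Submodule ℝ (Pt d → ℝ) where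
  carrier := {v | ContinuousOn v (closure Ω) ∧
    ∀ K, ∃ P ∈ M.shape.poly d l, ∀ x ∈ M.shape.ref d, v (M.map K x) = MvPolynomial.eval x P}
  zero_mem' := ⟨continuousOn_const, fun _ => ⟨0, Submodule.zero_mem _, fun _ _ => by simp⟩⟩
  add_mem' := by
    rintro v w ⟨hv, hv'⟩ ⟨hw, hw'⟩
    refine ⟨hv.add hw, fun K => ?_⟩
    obtain ⟨P, hP, h⟩ := hv' K
    obtain ⟨R, hR, k⟩ := hw' K
    exact ⟨P + R, Submodule.add_mem _ hP hR, fun x hx => by simp [h x hx, k x hx]⟩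
  smul_mem' := by
    rintro c v ⟨hv, hv'⟩
    refine ⟨hv.const_smul c, fun K => ?_⟩
    obtain ⟨P, hP, h⟩ := hv' K
    exact ⟨c • P, Submodule.smul_mem _ c hP, fun x hx => by simp [h x hx, MvPolynomial.smul_eval]⟩

/-- The vector-valued space `[Y_h^l]^d`, as a subspace of `L²(Ω; ℝ^d)`. -/
def YhVec (l : ℕ) : Submodule ℝ (L2 Ω (Pt d)) where
  carrier := {v | ∃ y : Pt d → Pt d, (∀ i, (fun x => y x i) ∈ M.Yh l) ∧
    v =ᵐ[volume.restrict Ω] y}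
  zero_mem' := ⟨0, fun _ => Submodule.zero_mem (M.Yh l), Lp.coeFn_zero _ _ _⟩
  add_mem' := by
    rintro v w ⟨y, hy, hv⟩ ⟨z, hz, hw⟩
    exact ⟨y + z, fun i => Submodule.add_mem _ (hy i) (hz i),
      (Lp.coeFn_add _ _).trans (hv.add hw)⟩
  smul_mem' := by
    rintro c v ⟨y, hy, hv⟩
    exact ⟨c • y, fun i => Submodule.smul_mem _ c (hy i),
      (Lp.coeFn_smul _ _).trans (hv.const_smul c)⟩

/-- The finite element velocity space `X_h = [Y_h^l]^d ∩ [H_0^1(Ω)]^d`. -/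
def Xh (l : ℕ) : Submodule ℝ (H10 Ω) := (M.YhVec l).comap H10.toL2

/-- The finite element pressure space `Q_h = Y_h^l`, whose members are regarded as elements of
`H^1(Ω)`. -/
def Qh (l : ℕ) : Submodule ℝ (H1 Ω) where
  carrier := {q | ∃ y ∈ M.Yh l, q.toL2 =ᵐ[volume.restrict Ω] y}
  zero_mem' := ⟨0, Submodule.zero_mem _, Lp.coeFn_zero _ _ _⟩
  add_mem' := by
    rintro v w ⟨y, hy, hv⟩ ⟨z, hz, hw⟩
    exact ⟨y + z, Submodule.add_mem _ hy hz, (Lp.coeFn_add _ _).trans (hv.add hw)⟩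
  smul_mem' := by
    rintro c v ⟨y, hy, hv⟩
    exact ⟨c • y, Submodule.smul_mem _ c hy, (Lp.coeFn_smul _ _).trans (hv.const_smul c)⟩

/-- `(v, w)_τ = ∑_K τ_K (v, w)_K`. -/
def tauInner (τ : Fin M.numCells → ℝ) (v w : L2 Ω (Pt d)) : ℝ :=
  ∑ K, τ K * ∫ x in M.cell K, inner ℝ (v x) (w x) ∂(volume.restrict Ω)

/-- `‖v‖_τ = (v, v)_τ^{1/2}`. -/
def tauNorm (τ : Fin M.numCells → ℝ) (v : L2 Ω (Pt d)) : ℝ := Real.sqrt (M.tauInner τ v v)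

end Mesh

/-- The fluctuation operator `Π* = Id - Π`. -/
def fluct {d : ℕ} {Ω : Set (Pt d)} (Pi : L2 Ω (Pt d) →ₗ[ℝ] L2 Ω (Pt d)) :
    L2 Ω (Pt d) →ₗ[ℝ] L2 Ω (Pt d) :=
  LinearMap.id - Pi

/-! ### The backward Euler LPS scheme -/

/-- One step of the fully implicit backward Euler LPS method on the pair of spaces `(X, Q)`: given
the velocity `u`, the pair `(u', p')` solves the discrete problem with right-hand side `g`. -/
structure IsLPSStep {d : ℕ} {Ω : Set (Pt d)} (M : Mesh Ω) (τ : Fin M.numCells → ℝ)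
    (Pi : L2 Ω (Pt d) →ₗ[ℝ] L2 Ω (Pt d)) (ν σ Δt : ℝ) (X : Submodule ℝ (H10 Ω))
    (Q : Submodule ℝ (H1 Ω)) (g : HMinusOne Ω) (u u' : H10 Ω) (p' : H1 Ω) : Prop where
  velocity_mem : u' ∈ X
  pressure_mem : p' ∈ Q
  momentum : ∀ v ∈ X,
    inner ℝ (Δt⁻¹ • (u' - u).toL2) v.toL2 + convForm u' u' v + ν * inner ℝ u'.grad v.grad
      - inner ℝ p'.toL2 v.div = g v
  continuity : ∀ q ∈ Q,
    inner ℝ u'.div q.toL2 + M.tauInner τ (fluct Pi p'.grad) (fluct Pi q.grad)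
      + σ * inner ℝ p'.toL2 q.toL2 = 0

/-- `(u^n, p^n)` is a solution of the fully implicit backward Euler LPS scheme on the pair of spaces
`(X, Q)` with `N` steps of length `Δt`, initial velocity `u₀` and forces `f^n = f(n Δt)`. (`p^0` and
the values beyond step `N` play no role.) -/
structure IsLPSSolution {d : ℕ} {Ω : Set (Pt d)} (M : Mesh Ω) (τ : Fin M.numCells → ℝ)
    (Pi : L2 Ω (Pt d) →ₗ[ℝ] L2 Ω (Pt d)) (ν σ Δt : ℝ) (N : ℕ) (X : Submodule ℝ (H10 Ω))
    (Q : Submodule ℝ (H1 Ω)) (f : ℝ → HMinusOne Ω) (u₀ : H10 Ω)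
    (u : ℕ → H10 Ω) (p : ℕ → H1 Ω) : Prop where
  init_mem : u₀ ∈ X
  init : u 0 = u₀
  step : ∀ n < N,
    IsLPSStep M τ Pi ν σ Δt X Q (f (((n + 1 : ℕ) : ℝ) * Δt)) (u n) (u (n + 1)) (p (n + 1))

/-! ### Proper orthogonal decomposition -/

/-- The snapshot correlation matrix `K_{mn} = Δt (s^n, s^m)_H`; `emb` is the embedding of the space
of the snapshots into the Hilbert space `H`. -/
def corrMatrix {V H : Type} [AddCommGroup V] [Module ℝ V] [NormedAddCommGroup H]
    [InnerProductSpace ℝ H] (emb : V →ₗ[ℝ] H) (Δt : ℝ) {N : ℕ} (s : Fin N → V) :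
    Matrix (Fin N) (Fin N) ℝ :=
  Matrix.of fun m n => Δt * inner ℝ (emb (s n)) (emb (s m))

/-- `φ_1, …, φ_r` is a POD basis of the snapshots `s^1, …, s^N`: with orthonormal eigenvectors `a_i`
of the correlation matrix that belong to its `r` largest eigenvalues
`lam_1 ≥ … ≥ lam_r > 0`, one has `φ_i = lam_i^{-1/2} Δt^{1/2} ∑_n (a_i)_n s^n`. -/
def IsPODBasis {V H : Type} [AddCommGroup V] [Module ℝ V] [NormedAddCommGroup H]
    [InnerProductSpace ℝ H] (emb : V →ₗ[ℝ] H) (Δt : ℝ) {N r : ℕ} (s : Fin N → V)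
    (φ : Fin r → V) : Prop :=
  ∃ (lam : Fin r → ℝ) (a : Fin r → EuclideanSpace ℝ (Fin N)),
    Orthonormal ℝ a ∧ Antitone lam ∧ (∀ i, 0 < lam i) ∧
    (∀ i, (corrMatrix emb Δt s).toEuclideanLin (a i) = lam i • a i) ∧
    (∀ (μ : ℝ) (x : EuclideanSpace ℝ (Fin N)), x ≠ 0 →
      (corrMatrix emb Δt s).toEuclideanLin x = μ • x → (∀ j, inner ℝ (a j) x = 0) →
        ∀ i, μ ≤ lam i) ∧
    ∀ i, φ i = ((1 / Real.sqrt (lam i)) * Real.sqrt Δt) • ∑ n, a i n • s n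

/-- The reduced space `span {φ_1, …, φ_r}`. -/
def podSpace {V : Type} [AddCommGroup V] [Module ℝ V] {r : ℕ} (φ : Fin r → V) : Submodule ℝ V :=
  Submodule.span ℝ (range φ)

/-- The reduced initial velocity `∑_i (u₀, φ_i) φ_i`. -/
def podInit {d : ℕ} {Ω : Set (Pt d)} {r : ℕ} (φ : Fin r → H10 Ω) (u₀ : H10 Ω) : H10 Ω :=
  ∑ i, (inner ℝ u₀.toL2 (φ i).toL2 : ℝ) • φ i

end LPSROM

end

noncomputable section

namespace LPSROM

/-! ### Zeros of coercive maps -/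

section Retraction

/-! In coordinates with respect to the POD modes, one time step is a finite system of equations with
a linear and a quadratic part. Add its two equations and test with the unknown pair itself.
Convection vanishes by skew-symmetry, the two pressure-divergence terms cancel, and the viscous and
stabilization terms are nonnegative. The terms `Δt⁻¹ ‖u‖²` and `σ ‖p‖²` then bound the unknowns
without any inf-sup condition. The modes are `L²`-orthonormal (`IsPODBasis.orthonormal`), so these
norms are the Euclidean norms of the coefficients and the system is coercive outside a ball.

A coercive `C¹` map on a Euclidean space has a zero (`exists_zero_of_coercive`); otherwise
normalizing it would give a `C¹` retraction of a ball onto its sphere. Such a retraction is excluded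
by a volume argument. If `g` vanishes on the sphere, then for small `t` the map `x + t g(x)` is a
bijection of the ball with positive Jacobian, so the integral of `det (I + t Dg)` is the volume of
the ball. This integral is a polynomial in `t`, so the identity holds at `t = 1`. For a retraction
`f = id + g`, however, `Df` is singular everywhere and the integral is zero.

The form `b` is trilinear only where its integrals converge. Finite element fields are bounded
(`Xh_le_boundedFields`), and the reduced modes inherit this.

The energy bound comes from the same test pair, the identity `2 (a - b, a) = ‖a‖² + ‖a - b‖² -
‖b‖²`, Young's inequality and summation over the steps. -/

theorem exists_polynomial_eval_eq_det {E : Type*} [NormedAddCommGroup E] [NormedSpace ℝ E]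
    [FiniteDimensional ℝ E] (A : E →L[ℝ] E) :
    ∃ P : Polynomial ℝ, P.natDegree ≤ Module.finrank ℝ E ∧
      ∀ t : ℝ, P.eval t = (ContinuousLinearMap.id ℝ E + t • A).det := by
  let b := Module.finBasis ℝ E
  let m := LinearMap.toMatrix b b (A : E →ₗ[ℝ] E)
  -- The degree bound depends on the dimension alone, so that one set of interpolation nodes will
  -- serve the derivatives at all points.
  refine ⟨Matrix.det ((Polynomial.X : Polynomial ℝ) • m.map Polynomial.C
    + (1 : Matrix _ _ ℝ).map Polynomial.C), ?_, fun t => ?_⟩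
  · simpa using Polynomial.natDegree_det_X_add_C_le m 1
  · rw [ContinuousLinearMap.det, ← LinearMap.det_toMatrix b, ← Polynomial.coe_evalRingHom,
      RingHom.map_det]
    congr 1
    ext i j
    simp [m, LinearMap.toMatrix_apply, Matrix.one_apply, Finsupp.single_apply]
    split_ifs <;> simp_all [eq_comm] <;> ring

/-- For `s ≤ t` a kernel vector of `I + s A` would satisfy `‖x‖ ≤ s ‖A‖ ‖x‖ < ‖x‖`. The determinant
therefore has no zero on `[0, t]`, and it starts from `1` at `s = 0`. -/
theorem det_id_add_smul_pos {E : Type*} [NormedAddCommGroup E] [NormedSpace ℝ E]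
    [FiniteDimensional ℝ E] (A : E →L[ℝ] E) {t : ℝ} (ht : 0 ≤ t) (h : t * ‖A‖ < 1) :
    0 < (ContinuousLinearMap.id ℝ E + t • A).det := by
  obtain ⟨P, -, hP⟩ := exists_polynomial_eval_eq_det A
  have hne : ∀ s ∈ Icc 0 t, P.eval s ≠ 0 := by
    intro s hs h0
    rw [hP] at h0
    obtain ⟨x, hx, hx0⟩ := Submodule.exists_mem_ne_zero_of_ne_bot
      (LinearMap.bot_lt_ker_of_det_eq_zero h0).ne'
    have hx1 : x = -(s • A x) := by
      rw [LinearMap.mem_ker] at hx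
      exact eq_neg_of_add_eq_zero_left (by simpa using hx)
    have h1 : ‖x‖ ≤ s * ‖A‖ * ‖x‖ := by
      calc ‖x‖ = s * ‖A x‖ := by
            conv_lhs => rw [hx1]
            rw [norm_neg, norm_smul, Real.norm_of_nonneg hs.1]
        _ ≤ s * (‖A‖ * ‖x‖) := mul_le_mul_of_nonneg_left (A.le_opNorm x) hs.1
        _ = _ := by ring
    have h2 : s * ‖A‖ ≤ t * ‖A‖ := mul_le_mul_of_nonneg_right hs.2 (norm_nonneg _)
    have h3 : 0 < ‖x‖ := norm_pos_iff.2 hx0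
    nlinarith
  have hP0 : P.eval 0 = 1 := by
    rw [hP]; simp [ContinuousLinearMap.det]
  rw [← hP]
  by_contra hcon
  obtain ⟨s, hs, hs0⟩ := intermediate_value_Icc' ht P.continuous.continuousOn
    (show (0 : ℝ) ∈ Icc (P.eval t) (P.eval 0) from ⟨not_lt.1 hcon, by rw [hP0]; norm_num⟩)
  exact hne s hs hs0

/-- Extension by zero of a function that vanishes on a sphere preserves Lipschitz continuity. -/
theorem lipschitzWith_indicator_closedBall {E : Type*} [NormedAddCommGroup E] [NormedSpace ℝ E]
    {g : E → E} {ρ : ℝ} {L : NNReal} (hg : LipschitzOnWith L g (Metric.closedBall 0 ρ))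
    (h0 : ∀ x, ‖x‖ = ρ → g x = 0) :
    LipschitzWith L ((Metric.closedBall 0 ρ).indicator g) := by
  have key : ∀ x ∈ Metric.closedBall (0 : E) ρ, ∀ y ∉ Metric.closedBall (0 : E) ρ,
      ‖g x‖ ≤ L * dist x y := by
    intro x hx y hy
    have hx' : ‖x‖ ≤ ρ := by simpa using hx
    have hy' : ρ ≤ ‖y‖ := by simp at hy; exact hy.le
    -- The segment from `x` to `y` crosses the sphere at a point where `g` vanishes, no farther from
    -- `x` than `y` is; the Lipschitz bound is applied between `x` and that point.
    have hc : ContinuousOn (fun s : ℝ => ‖x + s • (y - x)‖) (Icc 0 1) := by fun_prop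
    obtain ⟨s, hs, hsρ⟩ := intermediate_value_Icc zero_le_one hc
      (show ρ ∈ Icc _ _ from ⟨by simpa using hx', by simpa using hy'⟩)
    simp only at hsρ
    have h1 := hg.dist_le_mul x hx (x + s • (y - x)) (by simp [hsρ])
    rw [h0 _ hsρ, dist_zero_right] at h1
    refine h1.trans (mul_le_mul_of_nonneg_left ?_ L.2)
    rw [dist_self_add_right, norm_smul, Real.norm_of_nonneg hs.1, dist_comm, dist_eq_norm]
    exact mul_le_of_le_one_left (norm_nonneg _) hs.2
  refine LipschitzWith.of_dist_le_mul fun x y => ?_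
  by_cases hx : x ∈ Metric.closedBall (0 : E) ρ <;> by_cases hy : y ∈ Metric.closedBall (0 : E) ρ
  · rw [indicator_of_mem hx, indicator_of_mem hy]
    exact hg.dist_le_mul x hx y hy
  · rw [indicator_of_mem hx, indicator_of_notMem hy, dist_zero_right]
    exact key x hx y hy
  · rw [indicator_of_notMem hx, indicator_of_mem hy, dist_zero_left, dist_comm]
    exact key y hy x hx
  · rw [indicator_of_notMem hx, indicator_of_notMem hy, dist_self]
    positivity

/-- A small Lipschitz perturbation of the identity is bijective. -/
theorem bijective_add_smul {E : Type*} [NormedAddCommGroup E] [NormedSpace ℝ E] [CompleteSpace E]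
    {g : E → E} {L : NNReal} (hg : LipschitzWith L g) {t : NNReal} (h : t * L < 1) :
    Function.Bijective fun x => x + t • g x := by
  -- The solutions of `x + t g(x) = y` are the fixed points of the contraction `x ↦ y - t g(x)`.
  have hlip : ∀ y, ContractingWith (t * L) fun x => y - t • g x := by
    refine fun y => ⟨h, LipschitzWith.of_dist_le_mul fun a b => ?_⟩
    rw [dist_sub_left, NNReal.smul_def, NNReal.smul_def, dist_smul₀]
    have := mul_le_mul_of_nonneg_left (hg.dist_le_mul a b) t.2
    simpa [mul_assoc] using this
  constructor
  · intro a b hab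
    simp only at hab
    refine (hlip (a + t • g a)).fixedPoint_unique' (x := a) (y := b) ?_ ?_
    · simp [Function.IsFixedPt]
    · rw [Function.IsFixedPt, hab]; simp
  · intro y
    refine ⟨(hlip y).fixedPoint, ?_⟩
    have := (hlip y).fixedPoint_isFixedPt
    rw [Function.IsFixedPt] at this
    simp only
    nth_rewrite 1 [← this]
    simp

variable {ι : Type*} [Fintype ι]

/-- For small `t`, the deformation `x + t g(x)`, with `g` vanishing on the boundary of a ball,
preserves the volume of the ball. -/
theorem integral_det_id_add_smul {g : EuclideanSpace ℝ ι → EuclideanSpace ℝ ι}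
    (hg : ContDiff ℝ 1 g) {ρ : ℝ} (h0 : ∀ x, ‖x‖ = ρ → g x = 0) {L : NNReal}
    (hL : LipschitzOnWith L g (Metric.closedBall 0 ρ)) {t : NNReal} (ht : t * L < 1) :
    ∫ x in Metric.ball 0 ρ, (ContinuousLinearMap.id ℝ _ + (t : ℝ) • fderiv ℝ g x).det =
      volume.real (Metric.ball (0 : EuclideanSpace ℝ ι) ρ) := by
  set B : Set (EuclideanSpace ℝ ι) := Metric.ball 0 ρ
  -- Cutting `g` off outside the ball makes the deformation a bijection of the whole space that
  -- fixes the complement of `B` pointwise, so it must map `B` onto itself.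
  set k := fun x => x + t • (Metric.closedBall (0 : EuclideanSpace ℝ ι) ρ).indicator g x with hk
  have hbij : Function.Bijective k := bijective_add_smul (lipschitzWith_indicator_closedBall hL h0) ht
  have hout : ∀ x ∉ B, k x = x := by
    intro x hx
    have : (Metric.closedBall (0 : EuclideanSpace ℝ ι) ρ).indicator g x = 0 := by
      by_cases h : x ∈ Metric.closedBall (0 : EuclideanSpace ℝ ι) ρ
      · rw [indicator_of_mem h]
        refine h0 x (le_antisymm (by simpa using h) (by simpa [B] using hx))
      · rw [indicator_of_notMem h]
    simp [hk, this]
  have himg : k '' B = B := by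
    apply Subset.antisymm
    · rintro _ ⟨x, hx, rfl⟩
      by_contra hcon
      exact hcon (by rwa [hbij.1 (hout _ hcon)])
    · intro y hy
      obtain ⟨x, rfl⟩ := hbij.2 y
      by_cases hx : x ∈ B
      · exact ⟨x, hx, rfl⟩
      · rw [hout x hx] at hy; exact absurd hy hx
  have hder : ∀ x ∈ B, HasFDerivWithinAt k
      (ContinuousLinearMap.id ℝ _ + (t : ℝ) • fderiv ℝ g x) B x := by
    intro x hx
    have h1 : HasFDerivAt (fun x => x + (t : ℝ) • g x)
        (ContinuousLinearMap.id ℝ _ + (t : ℝ) • fderiv ℝ g x) x :=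
      (hasFDerivAt_id x).add ((hg.differentiable (by simp) x).hasFDerivAt.const_smul (t : ℝ))
    refine h1.hasFDerivWithinAt.congr (fun y hy => ?_) ?_
    · simp [hk, indicator_of_mem (Metric.ball_subset_closedBall hy), NNReal.smul_def]
    · simp [hk, indicator_of_mem (Metric.ball_subset_closedBall hx), NNReal.smul_def]
  have hcv := integral_image_eq_integral_abs_det_fderiv_smul volume Metric.isOpen_ball.measurableSet
    hder hbij.1.injOn (fun _ => (1 : ℝ))
  rw [himg] at hcv
  have hvol : ∫ _ in B, (1 : ℝ) = volume.real B := by simp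
  rw [← hvol, hcv]
  refine setIntegral_congr_fun Metric.isOpen_ball.measurableSet fun x hx => ?_
  have hnorm : ‖fderiv ℝ g x‖ ≤ L :=
    (hg.differentiable (by simp) x).hasFDerivAt.le_of_lipschitzOn
      (Filter.mem_of_superset (Metric.isOpen_ball.mem_nhds hx) Metric.ball_subset_closedBall) hL
  have hpos := det_id_add_smul_pos (fderiv ℝ g x) t.2
    ((mul_le_mul_of_nonneg_left hnorm t.2).trans_lt (by exact_mod_cast ht))
  simp only [smul_eq_mul, mul_one]
  exact (abs_of_pos hpos).symm

/-- The volume identity persists for all `t`, since the determinant is a polynomial in `t`. -/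
theorem integral_det_id_add_fderiv {g : EuclideanSpace ℝ ι → EuclideanSpace ℝ ι}
    (hg : ContDiff ℝ 1 g) {ρ : ℝ} (h0 : ∀ x, ‖x‖ = ρ → g x = 0) :
    ∫ x in Metric.ball 0 ρ, (ContinuousLinearMap.id ℝ _ + fderiv ℝ g x).det =
      volume.real (Metric.ball (0 : EuclideanSpace ℝ ι) ρ) := by
  obtain ⟨L, hL⟩ := hg.contDiffOn.exists_lipschitzOnWith (n := 1) (by simp)
    (convex_closedBall (0 : EuclideanSpace ℝ ι) ρ) (isCompact_closedBall _ _)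
  set m := Module.finrank ℝ (EuclideanSpace ℝ ι)
  -- The nodes are distinct and satisfy `v i * L < 1`, so the identity for small `t` holds at each
  -- of them. A polynomial of degree at most `m` is determined by its values at `m + 1` nodes.
  let v : ℕ → NNReal := fun i => (i + 1 : NNReal)⁻¹ * (L + 1)⁻¹
  have hvinj : Function.Injective v := by
    intro i j hij
    have h1 : (L + 1)⁻¹ ≠ 0 := by positivity
    have := mul_right_cancel₀ h1 hij
    simpa using this
  have hvL : ∀ i, v i * L < 1 := by
    intro i
    have h1 : (i + 1 : NNReal)⁻¹ ≤ 1 := inv_le_one_of_one_le₀ (by simp)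
    have h2 : (L + 1)⁻¹ * L < 1 := by
      rw [inv_mul_lt_iff₀ (by positivity)]; simp
    calc v i * L = (i + 1 : NNReal)⁻¹ * ((L + 1)⁻¹ * L) := by simp only [v]; ring
      _ ≤ 1 * ((L + 1)⁻¹ * L) := by gcongr
      _ < 1 := by simpa using h2
  let s := Finset.range (m + 1)
  -- These weights extrapolate from the nodes to `t = 1`. They do not depend on `x`, so they can be
  -- taken out of the integral.
  let w : ℕ → ℝ := fun i => (Lagrange.basis s (fun i => (v i : ℝ)) i).eval 1
  have hinj : Set.InjOn (fun i => (v i : ℝ)) s := fun i _ j _ h => hvinj (NNReal.coe_injective h)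
  have hw : ∑ i ∈ s, w i = 1 := by
    have := congrArg (Polynomial.eval 1) (Lagrange.sum_basis hinj ⟨0, by simp [s]⟩)
    simpa [Polynomial.eval_finsetSum] using this
  have hdet : ∀ x, (ContinuousLinearMap.id ℝ _ + fderiv ℝ g x).det =
      ∑ i ∈ s, w i * (ContinuousLinearMap.id ℝ _ + (v i : ℝ) • fderiv ℝ g x).det := by
    intro x
    obtain ⟨P, hPd, hP⟩ := exists_polynomial_eval_eq_det (fderiv ℝ g x)
    have hdeg : P.degree < s.card := by
      refine lt_of_le_of_lt Polynomial.degree_le_natDegree ?_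
      simp only [s, Finset.card_range]
      exact_mod_cast Nat.lt_succ_of_le hPd
    have h1 := congrArg (Polynomial.eval 1) (Lagrange.eq_interpolate hinj hdeg)
    rw [hP, one_smul] at h1
    rw [h1, Lagrange.interpolate_apply, Polynomial.eval_finsetSum]
    refine Finset.sum_congr rfl fun i _ => ?_
    rw [Polynomial.eval_mul, Polynomial.eval_C, hP, mul_comm]
  have hcont : ∀ t : ℝ, Continuous fun x =>
      (ContinuousLinearMap.id ℝ _ + t • fderiv ℝ g x).det := fun t =>
    ContinuousLinearMap.continuous_det.comp
      (continuous_const.add ((hg.continuous_fderiv (by simp)).const_smul t))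
  have hint : ∀ t : ℝ, IntegrableOn (fun x =>
      (ContinuousLinearMap.id ℝ _ + t • fderiv ℝ g x).det) (Metric.ball 0 ρ) := fun t =>
    ((hcont t).continuousOn.integrableOn_compact (isCompact_closedBall 0 ρ)).mono_set
      Metric.ball_subset_closedBall
  simp_rw [hdet]
  rw [integral_finsetSum _ fun i _ => (hint _).const_mul _]
  simp_rw [integral_const_mul, integral_det_id_add_smul hg h0 hL (hvL _)]
  rw [← Finset.sum_mul, hw, one_mul]

/-- There is no continuously differentiable retraction of a ball onto its boundary. -/
theorem not_exists_retraction {f : EuclideanSpace ℝ ι → EuclideanSpace ℝ ι}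
    (hf : ContDiff ℝ 1 f) {ρ : ℝ} (hρ : 0 < ρ) (hid : ∀ x, ‖x‖ = ρ → f x = x)
    (hnorm : ∀ x, ‖f x‖ = ρ) : False := by
  have h := integral_det_id_add_fderiv (g := fun x => f x - x) (hf.sub contDiff_id)
    (fun x hx => sub_eq_zero.2 (hid x hx))
  have hdet : ∀ x, (ContinuousLinearMap.id ℝ _ + fderiv ℝ (fun x => f x - x) x).det = 0 := by
    intro x
    have hd := (hf.differentiable (by simp) x).hasFDerivAt
    have h1 : ContinuousLinearMap.id ℝ _ + fderiv ℝ (fun x => f x - x) x = fderiv ℝ f x := by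
      have h2 : HasFDerivAt (fun x => f x - x) (fderiv ℝ f x - ContinuousLinearMap.id ℝ _) x :=
        hd.sub (hasFDerivAt_id x)
      rw [h2.fderiv]; abel
    rw [h1]
    -- Since `‖f‖²` is constant, `f x` is orthogonal to the range of `Df(x)`. If `Df(x)` were
    -- invertible, `f x` would lie in that range and be orthogonal to itself, although its norm is
    -- `ρ > 0`.
    by_contra hne
    have hsurj := (LinearMap.equivOfDetNeZero
      (fderiv ℝ f x : EuclideanSpace ℝ ι →ₗ[ℝ] EuclideanSpace ℝ ι) hne).surjective
    obtain ⟨y, hy⟩ := hsurj (f x)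
    have h2 := hd.norm_sq
    have h3 : HasFDerivAt (fun x => ‖f x‖ ^ 2) (0 : EuclideanSpace ℝ ι →L[ℝ] ℝ) x := by
      simp_rw [hnorm]; exact hasFDerivAt_const _ _
    have h4 := congrArg (fun T => T y) (h2.unique h3)
    have hy' : fderiv ℝ f x y = f x := hy
    simp [hy', hnorm, hρ.ne'] at h4
  simp_rw [hdet] at h
  rw [integral_zero] at h
  have : 0 < volume.real (Metric.ball (0 : EuclideanSpace ℝ ι) ρ) :=
    ENNReal.toReal_pos (Metric.measure_ball_pos _ _ hρ).ne' measure_ball_lt_top.ne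
  exact this.ne h

/-- A continuously differentiable map on a Euclidean space which is outward pointing away from a
bounded set has a zero. -/
theorem exists_zero_of_coercive {F : EuclideanSpace ℝ ι → EuclideanSpace ℝ ι}
    (hF : ContDiff ℝ 1 F) {R : ℝ} (hR : 0 < R) (hpos : ∀ x, R ≤ ‖x‖ → 0 < inner ℝ (F x) x) :
    ∃ x, F x = 0 := by
  by_contra! hne
  let χ : ContDiffBump (0 : EuclideanSpace ℝ ι) := ⟨R, 2 * R, hR, by linarith⟩
  -- `H` equals `F` on the ball of radius `R` and the identity on and beyond the sphere of radius `2
  -- * R`. Outside the inner ball `(H x, x)` is a convex combination of two positive numbers, so `H`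
  -- has no zero if `F` has none, and rescaling it to length `2 * R` gives a retraction.
  let H : EuclideanSpace ℝ ι → EuclideanSpace ℝ ι := fun x => χ x • F x + (1 - χ x) • x
  have hχ : ContDiff ℝ 1 χ := χ.contDiff
  have hH : ContDiff ℝ 1 H :=
    (hχ.smul hF).add ((contDiff_const.sub hχ).smul contDiff_id)
  have hH0 : ∀ x, H x ≠ 0 := by
    intro x hx
    rcases le_total ‖x‖ R with h | h
    · have : χ x = 1 := χ.one_of_mem_closedBall (by simpa [χ] using h)
      exact hne x (by simpa [H, this] using hx)
    · have h1 : inner ℝ (H x) x = χ x * inner ℝ (F x) x + (1 - χ x) * ‖x‖ ^ 2 := by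
        simp [H, inner_add_left, real_inner_smul_left]
      rw [hx, inner_zero_left] at h1
      have h2 := hpos x h
      have h3 : 0 < ‖x‖ ^ 2 := by have := hR.trans_le h; positivity
      have h4 := χ.nonneg (x := x)
      have h5 := χ.le_one (x := x)
      rcases h4.eq_or_lt with h6 | h6
      · rw [← h6] at h1; linarith
      · nlinarith [mul_pos h6 h2, mul_nonneg (sub_nonneg.2 h5) h3.le]
  refine not_exists_retraction (f := fun x => (2 * R / ‖H x‖) • H x) (ρ := 2 * R) ?_
    (by linarith) ?_ ?_
  · exact (contDiff_const.div (hH.norm ℝ hH0) fun x => norm_ne_zero_iff.2 (hH0 x)).smul hH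
  · intro x hx
    have : χ x = 0 := χ.zero_of_le_dist (by simp [χ, hx])
    have hHx : H x = x := by simp [H, this]
    simp only [hHx, hx]
    rw [div_self (by linarith), one_smul]
  · intro x
    rw [norm_smul, norm_div, norm_norm, div_mul_cancel₀ _ (norm_ne_zero_iff.2 (hH0 x)),
      Real.norm_of_nonneg (by linarith)]

end Retraction

/-! ### Finite-dimensional variational problems with a quadratic term -/

section Galerkin

variable {ι : Type*} [Fintype ι]

theorem contDiff_bilin_apply_self {E : Type*} [NormedAddCommGroup E] [NormedSpace ℝ E]
    [FiniteDimensional ℝ E] (B : E →ₗ[ℝ] E →ₗ[ℝ] ℝ) : ContDiff ℝ 1 fun x => B x x := by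
  let B' : E →L[ℝ] E →L[ℝ] ℝ :=
    LinearMap.toContinuousLinearMap (LinearMap.toContinuousLinearMap.toLinearMap ∘ₗ B)
  exact B'.contDiff.clm_apply contDiff_id

/-- Solvability of a finite-dimensional variational problem with a linear and a quadratic term,
under coercivity outside a ball. -/
theorem exists_forall_eq_of_coercive
    (A : EuclideanSpace ℝ ι →ₗ[ℝ] EuclideanSpace ℝ ι →ₗ[ℝ] ℝ)
    (B : EuclideanSpace ℝ ι →ₗ[ℝ] EuclideanSpace ℝ ι →ₗ[ℝ] EuclideanSpace ℝ ι →ₗ[ℝ] ℝ)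
    (ℓ : EuclideanSpace ℝ ι →ₗ[ℝ] ℝ) {R : ℝ} (hR : 0 < R)
    (hpos : ∀ x, R ≤ ‖x‖ → 0 < A x x + B x x x - ℓ x) :
    ∃ x, ∀ y, A x y + B x x y = ℓ y := by
  classical
  let e : ι → EuclideanSpace ℝ ι := fun k => EuclideanSpace.single k 1
  -- `F x` is the Riesz representative of the residual functional, so its zeros are the solutions
  -- and `(F x, x)` is the quantity assumed positive.
  let F : EuclideanSpace ℝ ι → EuclideanSpace ℝ ι := fun x =>
    WithLp.toLp 2 fun k => A x (e k) + B x x (e k) - ℓ (e k)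
  have hF : ContDiff ℝ 1 F := by
    rw [contDiff_euclidean]
    intro k
    have h1 : ContDiff ℝ 1 fun x => A x (e k) :=
      (LinearMap.toContinuousLinearMap (A.flip (e k))).contDiff
    have h2 : ContDiff ℝ 1 fun x => B x x (e k) :=
      contDiff_bilin_apply_self (B.compr₂ (LinearMap.applyₗ (e k)))
    exact (h1.add h2).sub contDiff_const
  have hinner : ∀ x y, inner ℝ (F x) y = A x y + B x x y - ℓ y := by
    intro x y
    have hy : y = ∑ k, y k • e k := by
      ext i
      simp [e, Pi.single_apply]
    conv_rhs => rw [hy]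
    simp only [map_sum, map_smul, smul_eq_mul, PiLp.inner_apply, F]
    rw [← Finset.sum_add_distrib, ← Finset.sum_sub_distrib]
    refine Finset.sum_congr rfl fun k _ => ?_
    simp
    ring
  obtain ⟨x, hx⟩ := exists_zero_of_coercive hF hR fun x h => by rw [hinner]; exact hpos x h
  exact ⟨x, fun y => by have := hinner x y; rw [hx, inner_zero_left] at this; linarith⟩

end Galerkin

/-! ### The convection form on bounded fields -/

section Forms

variable {d : ℕ} {Ω : Set (Pt d)}

/-- The essentially bounded velocity fields. -/
def boundedFields (Ω : Set (Pt d)) : Submodule ℝ (H10 Ω) where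
  carrier := {v | MemLp v.toL2 ⊤ (volume.restrict Ω)}
  zero_mem' := by
    change MemLp (H10.toL2 (0 : H10 Ω)) ⊤ (volume.restrict Ω)
    rw [map_zero]
    exact (memLp_congr_ae (Lp.coeFn_zero _ _ _)).2 MemLp.zero
  add_mem' := by
    intro v w hv hw
    change MemLp (H10.toL2 (v + w)) ⊤ (volume.restrict Ω)
    rw [map_add]
    exact (memLp_congr_ae (Lp.coeFn_add _ _)).2 (MemLp.add hv hw)
  smul_mem' := by
    intro c v hv
    change MemLp (H10.toL2 (c • v)) ⊤ (volume.restrict Ω)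
    rw [map_smul]
    exact (memLp_congr_ae (Lp.coeFn_smul _ _)).2 (MemLp.const_smul hv c)

/-- The integrand of `((u · ∇) v, w)`. -/
def convIntegrand (u v w : H10 Ω) (x : Pt d) : ℝ :=
  ∑ i, ∑ j, u.toL2 x j * v.grad x (i, j) * w.toL2 x i

/-- Hölder's inequality with exponents `∞, 2, 2`. Boundedness of the transport field alone suffices,
and no Sobolev embedding enters. -/
theorem integrable_convIntegrand {u : H10 Ω} (hu : u ∈ boundedFields Ω) (v w : H10 Ω) :
    Integrable (convIntegrand u v w) (volume.restrict Ω) := by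
  refine integrable_finsetSum _ fun i _ => integrable_finsetSum _ fun j _ => ?_
  have h1 : MemLp (fun x => u.toL2 x j) ⊤ (volume.restrict Ω) :=
    (EuclideanSpace.proj j : Pt d →L[ℝ] ℝ).comp_memLp' hu
  have h2 : MemLp (fun x => v.grad x (i, j)) 2 (volume.restrict Ω) :=
    (EuclideanSpace.proj (i, j) : Tens d →L[ℝ] ℝ).comp_memLp' (Lp.memLp v.grad)
  exact MemLp.integrable_mul (p := 2) (q := 2) (h2.mul h1) (memLp_coord w.toL2 i)

theorem convIntegrand_add_left (u u' v w : H10 Ω) :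
    convIntegrand (u + u') v w =ᵐ[volume.restrict Ω]
      convIntegrand u v w + convIntegrand u' v w := by
  filter_upwards [Lp.coeFn_add u.toL2 u'.toL2] with x hx
  simp only [convIntegrand, map_add, hx, Pi.add_apply, PiLp.add_apply, add_mul,
    Finset.sum_add_distrib]

theorem convIntegrand_smul_left (c : ℝ) (u v w : H10 Ω) :
    convIntegrand (c • u) v w =ᵐ[volume.restrict Ω] c • convIntegrand u v w := by
  filter_upwards [Lp.coeFn_smul c u.toL2] with x hx
  simp only [convIntegrand, map_smul, hx, Pi.smul_apply, PiLp.smul_apply, smul_eq_mul, mul_assoc,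
    Finset.mul_sum]

theorem convIntegrand_add_middle (u v v' w : H10 Ω) :
    convIntegrand u (v + v') w =ᵐ[volume.restrict Ω]
      convIntegrand u v w + convIntegrand u v' w := by
  filter_upwards [Lp.coeFn_add v.grad v'.grad] with x hx
  simp only [convIntegrand, map_add, hx, Pi.add_apply, PiLp.add_apply, add_mul, mul_add,
    Finset.sum_add_distrib]

theorem convIntegrand_smul_middle (c : ℝ) (u v w : H10 Ω) :
    convIntegrand u (c • v) w =ᵐ[volume.restrict Ω] c • convIntegrand u v w := by
  filter_upwards [Lp.coeFn_smul c v.grad] with x hx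
  simp only [convIntegrand, map_smul, hx, Pi.smul_apply, PiLp.smul_apply, smul_eq_mul, mul_assoc,
    Finset.mul_sum, mul_left_comm c]

theorem convIntegrand_add_right (u v w w' : H10 Ω) :
    convIntegrand u v (w + w') =ᵐ[volume.restrict Ω]
      convIntegrand u v w + convIntegrand u v w' := by
  filter_upwards [Lp.coeFn_add w.toL2 w'.toL2] with x hx
  simp only [convIntegrand, map_add, hx, Pi.add_apply, PiLp.add_apply, mul_add,
    Finset.sum_add_distrib]

theorem convIntegrand_smul_right (c : ℝ) (u v w : H10 Ω) :
    convIntegrand u v (c • w) =ᵐ[volume.restrict Ω] c • convIntegrand u v w := by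
  filter_upwards [Lp.coeFn_smul c w.toL2] with x hx
  simp only [convIntegrand, map_smul, hx, Pi.smul_apply, PiLp.smul_apply, smul_eq_mul, mul_assoc,
    Finset.mul_sum, mul_left_comm c]

/-- The trilinear form `((u · ∇) v, w)` for bounded `u`. -/
def advection : boundedFields Ω →ₗ[ℝ] H10 Ω →ₗ[ℝ] H10 Ω →ₗ[ℝ] ℝ where
  toFun u := LinearMap.mk₂ ℝ (fun v w => ∫ x in Ω, convIntegrand (u : H10 Ω) v w x)
    (fun v v' w => (integral_congr_ae (convIntegrand_add_middle (u : H10 Ω) v v' w)).trans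
      (integral_add (integrable_convIntegrand u.2 v w) (integrable_convIntegrand u.2 v' w)))
    (fun c v w => (integral_congr_ae (convIntegrand_smul_middle c (u : H10 Ω) v w)).trans
      (integral_const_mul c _))
    (fun v w w' => (integral_congr_ae (convIntegrand_add_right (u : H10 Ω) v w w')).trans
      (integral_add (integrable_convIntegrand u.2 v w) (integrable_convIntegrand u.2 v w')))
    (fun c v w => (integral_congr_ae (convIntegrand_smul_right c (u : H10 Ω) v w)).trans
      (integral_const_mul c _))
  map_add' u u' := LinearMap.ext₂ fun v w =>
    (integral_congr_ae (convIntegrand_add_left (u : H10 Ω) u' v w)).trans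
      (integral_add (integrable_convIntegrand u.2 v w) (integrable_convIntegrand u'.2 v w))
  map_smul' c u := LinearMap.ext₂ fun v w =>
    (integral_congr_ae (convIntegrand_smul_left c (u : H10 Ω) v w)).trans
      (integral_const_mul c _)

/-- The form `b` as a trilinear map, for bounded transport velocities. -/
def convTrilin : boundedFields Ω →ₗ[ℝ] H10 Ω →ₗ[ℝ] H10 Ω →ₗ[ℝ] ℝ where
  toFun u := (1 / 2 : ℝ) • (advection u - (advection u).flip)
  map_add' u u' := by
    ext v w
    simp only [map_add, LinearMap.smul_apply, LinearMap.sub_apply, LinearMap.add_apply,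
      LinearMap.flip_apply, smul_eq_mul]
    ring
  map_smul' c u := by
    ext v w
    simp only [map_smul, LinearMap.smul_apply, LinearMap.sub_apply, LinearMap.flip_apply,
      smul_eq_mul, RingHom.id_apply]
    ring

theorem convTrilin_apply (u : boundedFields Ω) (v w : H10 Ω) :
    convTrilin u v w = convForm (u : H10 Ω) v w := rfl

/-- The two integrals are literally the same, so neither a divergence constraint nor integrability
is needed. -/
theorem convForm_self (u v : H10 Ω) : convForm u v v = 0 := by
  simp [convForm]

/-- A finite element field agrees almost everywhere on `Ω` with a function continuous on the compact
set `closure Ω`. -/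
theorem Xh_le_boundedFields (hΩ_open : IsOpen Ω) (hΩ_bdd : Bornology.IsBounded Ω) (M : Mesh Ω)
    (l : ℕ) : M.Xh l ≤ boundedFields Ω := by
  rintro v ⟨y, hy, hvy⟩
  have hcomp : IsCompact (closure Ω) := hΩ_bdd.isCompact_closure
  have hcont : ContinuousOn y (closure Ω) := by
    rw [continuousOn_iff_continuous_domRestrict]
    refine (PiLp.continuous_toLp 2 _).comp (continuous_pi fun i => ?_)
    exact continuousOn_iff_continuous_domRestrict.1 (hy i).1
  obtain ⟨C, hC⟩ := hcomp.exists_bound_of_continuousOn hcont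
  refine memLp_top_of_bound (Lp.aestronglyMeasurable _) C ?_
  filter_upwards [hvy, ae_restrict_mem hΩ_open.measurableSet] with x hx hxΩ
  rw [hx]
  exact hC x (subset_closure hxΩ)

/-- The inner product `(·, ·)_τ` as a bilinear map. -/
def tauBilin (M : Mesh Ω) (τ : Fin M.numCells → ℝ) :
    L2 Ω (Pt d) →ₗ[ℝ] L2 Ω (Pt d) →ₗ[ℝ] ℝ :=
  LinearMap.mk₂ ℝ (M.tauInner τ)
    (fun v v' w => by
      simp only [Mesh.tauInner, ← Finset.sum_add_distrib, ← mul_add]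
      refine Finset.sum_congr rfl fun K _ => congrArg (τ K * ·) ?_
      rw [← integral_add (L2.integrable_inner v w).restrict (L2.integrable_inner v' w).restrict]
      refine integral_congr_ae (ae_restrict_of_ae ?_)
      filter_upwards [Lp.coeFn_add v v'] with x hx
      rw [hx, Pi.add_apply, inner_add_left])
    (fun c v w => by
      simp only [Mesh.tauInner, smul_eq_mul, Finset.mul_sum]
      refine Finset.sum_congr rfl fun K _ => ?_
      rw [mul_left_comm c, ← integral_const_mul c]
      refine congrArg (τ K * ·) (integral_congr_ae (ae_restrict_of_ae ?_))
      filter_upwards [Lp.coeFn_smul c v] with x hx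
      rw [hx, Pi.smul_apply, real_inner_smul_left])
    (fun v w w' => by
      simp only [Mesh.tauInner, ← Finset.sum_add_distrib, ← mul_add]
      refine Finset.sum_congr rfl fun K _ => congrArg (τ K * ·) ?_
      rw [← integral_add (L2.integrable_inner v w).restrict (L2.integrable_inner v w').restrict]
      refine integral_congr_ae (ae_restrict_of_ae ?_)
      filter_upwards [Lp.coeFn_add w w'] with x hx
      rw [hx, Pi.add_apply, inner_add_right])
    (fun c v w => by
      simp only [Mesh.tauInner, smul_eq_mul, Finset.mul_sum]
      refine Finset.sum_congr rfl fun K _ => ?_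
      rw [mul_left_comm c, ← integral_const_mul c]
      refine congrArg (τ K * ·) (integral_congr_ae (ae_restrict_of_ae ?_))
      filter_upwards [Lp.coeFn_smul c w] with x hx
      rw [hx, Pi.smul_apply, real_inner_smul_right])

theorem tauInner_self_nonneg (M : Mesh Ω) {τ : Fin M.numCells → ℝ} (hτ : ∀ K, 0 < τ K)
    (v : L2 Ω (Pt d)) : 0 ≤ M.tauInner τ v v :=
  Finset.sum_nonneg fun K _ => mul_nonneg (hτ K).le
    (integral_nonneg fun _ => real_inner_self_nonneg)

theorem tauNorm_sq (M : Mesh Ω) {τ : Fin M.numCells → ℝ} (hτ : ∀ K, 0 < τ K)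
    (v : L2 Ω (Pt d)) : M.tauNorm τ v ^ 2 = M.tauInner τ v v :=
  Real.sq_sqrt (tauInner_self_nonneg M hτ v)

end Forms

/-! ### POD bases -/

section POD

variable {V H : Type} [AddCommGroup V] [Module ℝ V] [NormedAddCommGroup H] [InnerProductSpace ℝ H]
  {emb : V →ₗ[ℝ] H} {Δt : ℝ} {N r : ℕ} {s : Fin N → V} {φ : Fin r → V}

theorem IsPODBasis.mem (h : IsPODBasis emb Δt s φ) {S : Submodule ℝ V} (hs : ∀ n, s n ∈ S)
    (i : Fin r) : φ i ∈ S := by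
  obtain ⟨lam, a, -, -, -, -, -, hφ⟩ := h
  rw [hφ]
  exact S.smul_mem _ (S.sum_mem fun n _ => S.smul_mem _ (hs n))

/-- The unscaled modes `∑ (a_i)_n s^n` have Gram matrix `Δt⁻¹ (a_i, K a_j) = Δt⁻¹ lam_j δ_ij`, with
`K` the correlation matrix; the prefactor in the definition of the modes normalizes exactly this. -/
theorem IsPODBasis.orthonormal (h : IsPODBasis emb Δt s φ) (hΔt : 0 < Δt) :
    Orthonormal ℝ fun i => emb (φ i) := by
  obtain ⟨lam, a, ha, -, hlam, heig, -, hφ⟩ := h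
  have hK : ∀ i j, Δt * inner ℝ (emb (∑ n, a i n • s n)) (emb (∑ n, a j n • s n)) =
      lam j * inner ℝ (a i) (a j) := by
    intro i j
    rw [← real_inner_smul_right (a i), ← heig j, map_sum, map_sum, sum_inner, Finset.mul_sum,
      PiLp.inner_apply]
    refine Finset.sum_congr rfl fun m _ => ?_
    rw [inner_sum, Finset.mul_sum]
    simp only [Matrix.toEuclideanLin, Matrix.toLpLin_apply, Matrix.mulVec, dotProduct, corrMatrix,
      Matrix.of_apply, map_smul, real_inner_smul_left, real_inner_smul_right, RCLike.inner_apply,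
      conj_trivial, Finset.sum_mul]
    refine Finset.sum_congr rfl fun n _ => ?_
    rw [real_inner_comm]
    ring
  rw [orthonormal_iff_ite] at ha ⊢
  intro i j
  have hij := hK i j
  rw [ha] at hij
  rw [hφ i, hφ j, map_smul, map_smul, real_inner_smul_left, real_inner_smul_right]
  split_ifs with hc
  · subst hc
    rw [if_pos rfl, mul_one] at hij
    have h1 := Real.sq_sqrt (hlam i).le
    have h2 := Real.sq_sqrt hΔt.le
    have h3 := Real.sqrt_pos.2 (hlam i)
    calc _ = (Real.sqrt Δt ^ 2 * inner ℝ (emb (∑ n, a i n • s n)) (emb (∑ n, a i n • s n)))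
          / Real.sqrt (lam i) ^ 2 := by ring
      _ = 1 := by rw [h1, h2, hij, div_self (hlam i).ne']
  · rw [if_neg hc, mul_zero] at hij
    rw [(mul_eq_zero.1 hij).resolve_left hΔt.ne']
    ring

end POD

/-! ### Solvability and energy estimate of the LPS scheme -/

section Steps

variable {d : ℕ} {Ω : Set (Pt d)} {M : Mesh Ω} {τ : Fin M.numCells → ℝ}
  {Pi : L2 Ω (Pt d) →ₗ[ℝ] L2 Ω (Pt d)} {ν σ Δt : ℝ}

/-- The combination of modes with coefficients taken from an embedded block of indices. -/
def modeSum {V : Type} [AddCommGroup V] [Module ℝ V] {r : ℕ} (e : Fin r → Fin r ⊕ Fin r)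
    (φ : Fin r → V) : EuclideanSpace ℝ (Fin r ⊕ Fin r) →ₗ[ℝ] V :=
  Fintype.linearCombination ℝ φ ∘ₗ LinearMap.funLeft ℝ ℝ e ∘ₗ
    (WithLp.linearEquiv 2 ℝ (Fin r ⊕ Fin r → ℝ)).toLinearMap

theorem modeSum_apply {V : Type} [AddCommGroup V] [Module ℝ V] {r : ℕ}
    (e : Fin r → Fin r ⊕ Fin r) (φ : Fin r → V) (x : EuclideanSpace ℝ (Fin r ⊕ Fin r)) :
    modeSum e φ x = ∑ i, x (e i) • φ i := rfl

theorem mode_mem {V : Type} [AddCommGroup V] [Module ℝ V] {r : ℕ} (φ : Fin r → V) (i : Fin r) :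
    φ i ∈ podSpace φ :=
  Submodule.subset_span (mem_range_self i)

theorem modeSum_mem {V : Type} [AddCommGroup V] [Module ℝ V] {r : ℕ}
    (e : Fin r → Fin r ⊕ Fin r) (φ : Fin r → V) (x : EuclideanSpace ℝ (Fin r ⊕ Fin r)) :
    modeSum e φ x ∈ podSpace φ := by
  rw [modeSum_apply]
  exact Submodule.sum_mem _ fun i _ => Submodule.smul_mem _ _ (mode_mem φ i)

/-- Parseval's identity. Summed over the velocity and pressure blocks, it turns `L²` control into
control of the coefficient vector. -/
theorem norm_sq_modeSum {V H : Type} [AddCommGroup V] [Module ℝ V] [NormedAddCommGroup H]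
    [InnerProductSpace ℝ H] {emb : V →ₗ[ℝ] H} {r : ℕ} {φ : Fin r → V}
    (h : Orthonormal ℝ fun i => emb (φ i)) (e : Fin r → Fin r ⊕ Fin r)
    (x : EuclideanSpace ℝ (Fin r ⊕ Fin r)) : ‖emb (modeSum e φ x)‖ ^ 2 = ∑ i, x (e i) ^ 2 := by
  rw [modeSum_apply, map_sum, ← real_inner_self_eq_norm_sq]
  simp only [map_smul]
  rw [h.inner_sum]
  simp [sq]

theorem exists_modeSum_eq {V W : Type} [AddCommGroup V] [Module ℝ V] [AddCommGroup W] [Module ℝ W]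
    {r : ℕ} {φ : Fin r → V} {ψ : Fin r → W} {v : V} {q : W} (hv : v ∈ podSpace φ)
    (hq : q ∈ podSpace ψ) : ∃ y, modeSum Sum.inl φ y = v ∧ modeSum Sum.inr ψ y = q := by
  obtain ⟨a, rfl⟩ := (Submodule.mem_span_range_iff_exists_fun ℝ).1 hv
  obtain ⟨b, rfl⟩ := (Submodule.mem_span_range_iff_exists_fun ℝ).1 hq
  exact ⟨WithLp.toLp 2 (Sum.elim a b), by simp [modeSum_apply], by simp [modeSum_apply]⟩

/-- The bilinear part of the sum of the two equations of one LPS step. -/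
def stepBilin (M : Mesh Ω) (τ : Fin M.numCells → ℝ) (Pi : L2 Ω (Pt d) →ₗ[ℝ] L2 Ω (Pt d))
    (ν σ Δt : ℝ) : (H10 Ω × H1 Ω) →ₗ[ℝ] (H10 Ω × H1 Ω) →ₗ[ℝ] ℝ :=
  let u := LinearMap.fst ℝ (H10 Ω) (H1 Ω)
  let p := LinearMap.snd ℝ (H10 Ω) (H1 Ω)
  Δt⁻¹ • (innerₗ (L2 Ω (Pt d))).compl₁₂ (H10.toL2 ∘ₗ u) (H10.toL2 ∘ₗ u)
    + ν • (innerₗ (L2 Ω (Tens d))).compl₁₂ (H10.grad ∘ₗ u) (H10.grad ∘ₗ u)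
    - (innerₗ (L2 Ω ℝ)).compl₁₂ (H1.toL2 ∘ₗ p) (H10.div ∘ₗ u)
    + (innerₗ (L2 Ω ℝ)).compl₁₂ (H10.div ∘ₗ u) (H1.toL2 ∘ₗ p)
    + (tauBilin M τ).compl₁₂ (fluct Pi ∘ₗ H1.grad ∘ₗ p) (fluct Pi ∘ₗ H1.grad ∘ₗ p)
    + σ • (innerₗ (L2 Ω ℝ)).compl₁₂ (H1.toL2 ∘ₗ p) (H1.toL2 ∘ₗ p)

theorem stepBilin_apply (z y : H10 Ω × H1 Ω) :
    stepBilin M τ Pi ν σ Δt z y = Δt⁻¹ * inner ℝ z.1.toL2 y.1.toL2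
      + ν * inner ℝ z.1.grad y.1.grad - inner ℝ z.2.toL2 y.1.div + inner ℝ z.1.div y.2.toL2
      + M.tauInner τ (fluct Pi z.2.grad) (fluct Pi y.2.grad)
      + σ * inner ℝ z.2.toL2 y.2.toL2 := rfl

/-- The weight in Young's inequality is chosen to spend exactly half of the viscous dissipation on
the force. -/
theorem apply_le_young (hν : 0 < ν) (g : HMinusOne Ω) (v : H10 Ω) :
    g v ≤ ν / 2 * ‖v.grad‖ ^ 2 + ‖g‖ ^ 2 / (2 * ν) := by
  have h1 : g v ≤ ‖g‖ * ‖v.grad‖ := (le_abs_self _).trans (g.le_opNorm v)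
  have h2 : ν / 2 * ‖v.grad‖ ^ 2 + ‖g‖ ^ 2 / (2 * ν) - ‖g‖ * ‖v.grad‖ =
      (ν * ‖v.grad‖ - ‖g‖) ^ 2 / (2 * ν) := by field_simp; ring
  have h3 : 0 ≤ (ν * ‖v.grad‖ - ‖g‖) ^ 2 / (2 * ν) := by positivity
  linarith

/-- One LPS step is solvable on the spans of bounded velocity modes and of pressure modes that are
orthonormal in `L²`. -/
theorem exists_isLPSStep (hτ : ∀ K, 0 < τ K) (hν : 0 < ν) (hσ : 0 < σ) (hΔt : 0 < Δt) {r : ℕ}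
    {φ : Fin r → H10 Ω} {ψ : Fin r → H1 Ω} (hφ : Orthonormal ℝ fun i => (φ i).toL2)
    (hψ : Orthonormal ℝ fun i => (ψ i).toL2) (hbdd : ∀ i, φ i ∈ boundedFields Ω)
    (g : HMinusOne Ω) (w : H10 Ω) :
    ∃ u p, IsLPSStep M τ Pi ν σ Δt (podSpace φ) (podSpace ψ) g w u p := by
  -- The transport slot of `convTrilin` accepts bounded fields only, so the same combination of
  -- modes is also formed inside that subspace.
  let φb : Fin r → boundedFields Ω := fun i => ⟨φ i, hbdd i⟩
  let Ub := modeSum Sum.inl φb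
  let U := modeSum Sum.inl φ
  let P := modeSum Sum.inr ψ
  have hUb : ∀ x, (Ub x : H10 Ω) = U x := fun x => by
    simp [Ub, U, modeSum_apply, φb]
  let A := (stepBilin M τ Pi ν σ Δt).compl₁₂ (U.prod P) (U.prod P)
  let B : EuclideanSpace ℝ (Fin r ⊕ Fin r) →ₗ[ℝ] EuclideanSpace ℝ (Fin r ⊕ Fin r) →ₗ[ℝ]
      EuclideanSpace ℝ (Fin r ⊕ Fin r) →ₗ[ℝ] ℝ :=
    { toFun := fun x => (convTrilin (Ub x)).compl₁₂ U U
      map_add' := fun x y => by ext; simp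
      map_smul' := fun c x => by ext; simp }
  let ℓ : EuclideanSpace ℝ (Fin r ⊕ Fin r) →ₗ[ℝ] ℝ :=
    (g.toLinearMap + Δt⁻¹ • (innerₗ (L2 Ω (Pt d)) w.toL2) ∘ₗ H10.toL2) ∘ₗ U
  have hA : ∀ x y, A x y = stepBilin M τ Pi ν σ Δt (U x, P x) (U y, P y) := fun _ _ => rfl
  have hB : ∀ x y, B x x y = convForm (U x) (U x) (U y) := fun x y => by
    rw [← hUb x]
    change convTrilin (Ub x) (U x) (U y) = _
    rw [convTrilin_apply, hUb x]
  have hℓ : ∀ y, ℓ y = g (U y) + Δt⁻¹ * inner ℝ w.toL2 (U y).toL2 := fun _ => rfl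
  have hnorm : ∀ x, ‖(U x).toL2‖ ^ 2 + ‖(P x).toL2‖ ^ 2 = ‖x‖ ^ 2 := fun x => by
    rw [norm_sq_modeSum hφ, norm_sq_modeSum hψ, EuclideanSpace.real_norm_sq_eq, Fintype.sum_sum_type]
  -- Half of `Δt⁻¹ ‖u‖²` absorbs the previous velocity `w`, and half of the viscous term absorbs
  -- `g`. The other half of the former and `σ ‖p‖²` give `c`; the data left over give `C`.
  set c := min (Δt⁻¹ / 2) σ with hc
  have hc0 : 0 < c := lt_min (by positivity) hσ
  set C := Δt⁻¹ / 2 * ‖w.toL2‖ ^ 2 + ‖g‖ ^ 2 / (2 * ν) with hC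
  have hC0 : 0 ≤ C := by positivity
  have hcoer : ∀ x, c * ‖x‖ ^ 2 - C ≤ A x x + B x x x - ℓ x := by
    intro x
    rw [hA, hB, hℓ, stepBilin_apply, convForm_self]
    simp only [real_inner_self_eq_norm_sq]
    rw [real_inner_comm (P x).toL2 (U x).div, ← hnorm]
    have h1 := apply_le_young hν g (U x)
    have h2 := tauInner_self_nonneg M hτ (fluct Pi (P x).grad)
    have h3 : inner ℝ w.toL2 (U x).toL2 ≤ ‖w.toL2‖ ^ 2 / 2 + ‖(U x).toL2‖ ^ 2 / 2 := by
      have := real_inner_le_norm w.toL2 (U x).toL2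
      nlinarith [sq_nonneg (‖w.toL2‖ - ‖(U x).toL2‖)]
    have h4 := mul_le_mul_of_nonneg_left h3 (inv_pos.2 hΔt).le
    have h5 := mul_le_mul_of_nonneg_right (min_le_left (Δt⁻¹ / 2) σ) (sq_nonneg ‖(U x).toL2‖)
    have h6 := mul_le_mul_of_nonneg_right (min_le_right (Δt⁻¹ / 2) σ) (sq_nonneg ‖(P x).toL2‖)
    have h7 : 0 ≤ ν / 2 * ‖(U x).grad‖ ^ 2 := by positivity
    rw [← hc] at h5 h6
    linarith
  -- If `‖x‖ ≥ 1 + C / c`, then `‖x‖ ≥ 1`, hence `‖x‖² ≥ ‖x‖ > C / c`, which makes the lower bound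
  -- `c ‖x‖² - C` positive.
  obtain ⟨x, hx⟩ := exists_forall_eq_of_coercive A B ℓ (R := 1 + C / c) (by positivity)
    fun x hxR => by
      have h1 : 0 ≤ C / c := by positivity
      have h2 : C = c * (C / c) := by field_simp
      have h3 : C / c < ‖x‖ ^ 2 := by nlinarith
      have h4 := mul_lt_mul_of_pos_left h3 hc0
      linarith [hcoer x]
  have key : ∀ v ∈ podSpace φ, ∀ q ∈ podSpace ψ,
      stepBilin M τ Pi ν σ Δt (U x, P x) (v, q) + convForm (U x) (U x) v =
        g v + Δt⁻¹ * inner ℝ w.toL2 v.toL2 := by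
    intro v hv q hq
    obtain ⟨y, rfl, rfl⟩ := exists_modeSum_eq hv hq
    have := hx y
    rwa [hA, hB, hℓ] at this
  -- The test pairs `(v, 0)` and `(0, q)` split the summed equation into momentum and continuity
  -- again.
  refine ⟨U x, P x, modeSum_mem _ _ x, modeSum_mem _ _ x, fun v hv => ?_, fun q hq => ?_⟩
  · have := key v hv 0 (Submodule.zero_mem _)
    rw [stepBilin_apply] at this
    have h0 : M.tauInner τ (fluct Pi (P x).grad) 0 = 0 :=
      (tauBilin M τ (fluct Pi (P x).grad)).map_zero
    simp only [map_zero, inner_zero_right, h0, mul_zero, add_zero] at this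
    rw [map_sub, real_inner_smul_left, inner_sub_left]
    linarith
  · have := key 0 (Submodule.zero_mem _) q hq
    rw [stepBilin_apply] at this
    have h0 : convForm (U x) (U x) 0 = 0 := by
      rw [← hUb x, ← convTrilin_apply, map_zero]
    simp only [map_zero, inner_zero_right, mul_zero, add_zero, h0, sub_zero, zero_add] at this
    linarith

/-- The energy inequality of one LPS step. -/
theorem IsLPSStep.energy {X : Submodule ℝ (H10 Ω)} {Q : Submodule ℝ (H1 Ω)} {g : HMinusOne Ω}
    {u u' : H10 Ω} {p' : H1 Ω} (h : IsLPSStep M τ Pi ν σ Δt X Q g u u' p')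
    (hτ : ∀ K, 0 < τ K) (hν : 0 < ν) (hσ : 0 < σ) (hΔt : 0 < Δt) :
    ‖u'.toL2‖ ^ 2 + ‖(u' - u).toL2‖ ^ 2 + Δt * (ν * ‖u'.grad‖ ^ 2
        + M.tauNorm τ (fluct Pi p'.grad) ^ 2 + σ * ‖p'.toL2‖ ^ 2)
      ≤ ‖u.toL2‖ ^ 2 + 4 * Δt / ν * ‖g‖ ^ 2 := by
  have h1 := h.momentum u' h.velocity_mem
  have h2 := h.continuity p' h.pressure_mem
  have h3 := tauInner_self_nonneg M hτ (fluct Pi p'.grad)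
  have h4 := apply_le_young hν g u'
  rw [convForm_self, real_inner_self_eq_norm_sq, real_inner_smul_left,
    real_inner_comm u'.div p'.toL2] at h1
  rw [real_inner_self_eq_norm_sq] at h2
  rw [tauNorm_sq M hτ]
  have h5 : inner ℝ (u' - u).toL2 u'.toL2 =
      (‖u'.toL2‖ ^ 2 + ‖(u' - u).toL2‖ ^ 2 - ‖u.toL2‖ ^ 2) / 2 := by
    have := norm_sub_sq_real u'.toL2 (u' - u).toL2
    rw [map_sub, sub_sub_cancel, ← map_sub, real_inner_comm] at this
    linarith
  rw [h5] at h1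
  -- The momentum equation tested with `u'` plus the continuity equation tested with `p'`,
  -- multiplied by `2 * Δt`; the pressure-divergence terms have cancelled.
  have h6 : (‖u'.toL2‖ ^ 2 + ‖(u' - u).toL2‖ ^ 2 - ‖u.toL2‖ ^ 2) =
      2 * Δt * (g u' - ν * ‖u'.grad‖ ^ 2 - M.tauInner τ (fluct Pi p'.grad) (fluct Pi p'.grad)
        - σ * ‖p'.toL2‖ ^ 2) := by
    have h7 : Δt⁻¹ * ((‖u'.toL2‖ ^ 2 + ‖(u' - u).toL2‖ ^ 2 - ‖u.toL2‖ ^ 2) / 2) =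
      g u' - ν * ‖u'.grad‖ ^ 2 - M.tauInner τ (fluct Pi p'.grad) (fluct Pi p'.grad)
        - σ * ‖p'.toL2‖ ^ 2 := by linarith
    rw [← h7]; field_simp
  have h8 := mul_le_mul_of_nonneg_left h4 (by positivity : 0 ≤ 2 * Δt)
  have h9 : 2 * Δt * (‖g‖ ^ 2 / (2 * ν)) = Δt / ν * ‖g‖ ^ 2 := by field_simp
  -- The argument gives the force term with constant `Δt / ν`, so the factor `4` is slack. One of
  -- the two copies of the stabilization and `σ` terms is likewise discarded.
  have h10 : 4 * Δt / ν * ‖g‖ ^ 2 = 4 * (Δt / ν * ‖g‖ ^ 2) := by ring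
  have h11 : 0 ≤ Δt / ν * ‖g‖ ^ 2 := by positivity
  have h12 := mul_nonneg hΔt.le h3
  have h13 : 0 ≤ Δt * (σ * ‖p'.toL2‖ ^ 2) := by positivity
  rw [mul_add, h9] at h8
  rw [h10]
  linarith

theorem podInit_mem {r : ℕ} (φ : Fin r → H10 Ω) (u₀ : H10 Ω) : podInit φ u₀ ∈ podSpace φ :=
  Submodule.sum_mem _ fun i _ => Submodule.smul_mem _ _ (mode_mem φ i)

/-- A scheme all of whose steps are solvable has a solution. -/
theorem exists_isLPSSolution {N : ℕ} {X : Submodule ℝ (H10 Ω)} {Q : Submodule ℝ (H1 Ω)}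
    {f : ℝ → HMinusOne Ω} {u₀ : H10 Ω} (hu₀ : u₀ ∈ X)
    (h : ∀ n < N, ∀ w ∈ X, ∃ u' p',
      IsLPSStep M τ Pi ν σ Δt X Q (f (((n + 1 : ℕ) : ℝ) * Δt)) w u' p') :
    ∃ u p, IsLPSSolution M τ Pi ν σ Δt N X Q f u₀ u p := by
  have h' : ∀ n (w : X), ∃ z : X × H1 Ω, n < N →
      IsLPSStep M τ Pi ν σ Δt X Q (f (((n + 1 : ℕ) : ℝ) * Δt)) w z.1 z.2 := by
    intro n w
    by_cases hn : n < N
    · obtain ⟨u', p', hs⟩ := h n hn w w.2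
      exact ⟨(⟨u', hs.velocity_mem⟩, p'), fun _ => hs⟩
    · exact ⟨0, fun hn' => absurd hn' hn⟩
  choose z hz using h'
  let u : ℕ → X := fun n => Nat.rec ⟨u₀, hu₀⟩ (fun n w => (z n w).1) n
  -- The pressure with index `n` is produced by step `n - 1`. At `n = 0` the truncated subtraction
  -- gives an irrelevant value.
  refine ⟨fun n => (u n).1, fun n => (z (n - 1) (u (n - 1))).2, ?_⟩
  exact { init_mem := hu₀, init := rfl, step := fun n hn => hz n (u n) hn }

theorem IsLPSSolution.energy {N : ℕ} {X : Submodule ℝ (H10 Ω)} {Q : Submodule ℝ (H1 Ω)}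
    {f : ℝ → HMinusOne Ω} {u₀ : H10 Ω} {u : ℕ → H10 Ω} {p : ℕ → H1 Ω}
    (h : IsLPSSolution M τ Pi ν σ Δt N X Q f u₀ u p)
    (hτ : ∀ K, 0 < τ K) (hν : 0 < ν) (hσ : 0 < σ) (hΔt : 0 < Δt) {k : ℕ} (hk : k ≤ N) :
    ‖(u k).toL2‖ ^ 2 + ∑ n ∈ Finset.range k, ‖(u (n + 1) - u n).toL2‖ ^ 2
        + Δt * ∑ n ∈ Finset.range k, (ν * ‖(u (n + 1)).grad‖ ^ 2
          + M.tauNorm τ (fluct Pi (p (n + 1)).grad) ^ 2 + σ * ‖(p (n + 1)).toL2‖ ^ 2)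
      ≤ ‖(u 0).toL2‖ ^ 2
        + 4 * Δt / ν * ∑ n ∈ Finset.range k, ‖f (((n + 1 : ℕ) : ℝ) * Δt)‖ ^ 2 := by
  induction k with
  | zero => simp
  | succ k ih =>
    have h1 := ih (by lia)
    have h2 := (h.step k (by lia)).energy hτ hν hσ hΔt
    simp only [Finset.sum_range_succ, mul_add] at h1 h2 ⊢
    linarith

end Steps

end LPSROM

end

/-! ### Existence and stability of the LPS-ROM -/

theorem theorem2 {d : ℕ} (hd : d = 2 ∨ d = 3) (Ω : Set (LPSROM.Pt d)) (hΩ_open : IsOpen Ω)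
    (hΩ_conn : IsConnected Ω) (hΩ_bdd : Bornology.IsBounded Ω)
    (M : LPSROM.Mesh Ω) (l : ℕ) (hl : 2 ≤ l)
    (τ : Fin M.numCells → ℝ) (hτ : ∀ K, 0 < τ K)
    (Pi : LPSROM.L2 Ω (LPSROM.Pt d) →ₗ[ℝ] LPSROM.L2 Ω (LPSROM.Pt d))
    (hPi : ∀ v, Pi v ∈ M.YhVec (l - 1))
    (ν σ T : ℝ) (hν : 0 < ν) (hσ : 0 < σ) (hT : 0 < T)
    (N : ℕ) (hN : 0 < N) (Δt : ℝ) (hΔt : Δt = T / N)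
    (f : ℝ → LPSROM.HMinusOne Ω)
    -- the finite element solution that provides the snapshots
    (u₀h : LPSROM.H10 Ω) (uh : ℕ → LPSROM.H10 Ω) (ph : ℕ → LPSROM.H1 Ω)
    (hFOM : LPSROM.IsLPSSolution M τ Pi ν σ Δt N (M.Xh l) (M.Qh l) f u₀h uh ph)
    -- the velocity and pressure modes
    (r : ℕ) (φ : Fin r → LPSROM.H10 Ω) (ψ : Fin r → LPSROM.H1 Ω)
    (hφ : LPSROM.IsPODBasis LPSROM.H10.toL2 Δt (fun n : Fin N => uh (n + 1)) φ)
    (hψ : LPSROM.IsPODBasis LPSROM.H1.toL2 Δt (fun n : Fin N => ph (n + 1)) ψ) :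
    -- every step of the reduced scheme is solvable
    (∀ n < N, ∀ w ∈ LPSROM.podSpace φ, ∃ u' p',
      LPSROM.IsLPSStep M τ Pi ν σ Δt (LPSROM.podSpace φ) (LPSROM.podSpace ψ)
        (f (((n + 1 : ℕ) : ℝ) * Δt)) w u' p') ∧
    -- the reduced scheme has a solution
    (∃ u p, LPSROM.IsLPSSolution M τ Pi ν σ Δt N (LPSROM.podSpace φ) (LPSROM.podSpace ψ) f
      (LPSROM.podInit φ u₀h) u p) ∧
    -- every solution satisfies the energy bound
    ∀ u p, LPSROM.IsLPSSolution M τ Pi ν σ Δt N (LPSROM.podSpace φ) (LPSROM.podSpace ψ) f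
        (LPSROM.podInit φ u₀h) u p →
      ∀ k ≤ N,
        ‖(u k).toL2‖ ^ 2 + ∑ n ∈ Finset.range k, ‖(u (n + 1) - u n).toL2‖ ^ 2
          + Δt * ∑ n ∈ Finset.range k, (ν * ‖(u (n + 1)).grad‖ ^ 2
            + M.tauNorm τ (LPSROM.fluct Pi (p (n + 1)).grad) ^ 2
            + σ * ‖(p (n + 1)).toL2‖ ^ 2)
        ≤ ‖(u 0).toL2‖ ^ 2
          + 4 * Δt / ν * ∑ n ∈ Finset.range k, ‖f (((n + 1 : ℕ) : ℝ) * Δt)‖ ^ 2 := by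
  have hΔt0 : 0 < Δt := by rw [hΔt]; exact div_pos hT (by exact_mod_cast hN)
  -- The snapshot with index `m` in `Fin N` is the velocity produced by step `m` of the full scheme.
  -- It lies in `M.Xh l`, so the modes spanned by the snapshots are bounded fields.
  have hsteps : ∀ n < N, ∀ w ∈ LPSROM.podSpace φ, ∃ u' p',
      LPSROM.IsLPSStep M τ Pi ν σ Δt (LPSROM.podSpace φ) (LPSROM.podSpace ψ)
        (f (((n + 1 : ℕ) : ℝ) * Δt)) w u' p' := fun n _ w _ =>
    LPSROM.exists_isLPSStep hτ hν hσ hΔt0 (hφ.orthonormal hΔt0) (hψ.orthonormal hΔt0)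
      (fun i => LPSROM.Xh_le_boundedFields hΩ_open hΩ_bdd M l
        (hφ.mem (fun m => (hFOM.step m m.2).velocity_mem) i)) _ w
  exact ⟨hsteps, LPSROM.exists_isLPSSolution (LPSROM.podInit_mem φ u₀h) hsteps,
    fun u p h k hk => h.energy hτ hν hσ hΔt0 hk⟩
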